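/- Let $\mathcal F$ be an ordinary differential field of characteristic $0$ with derivation $\delta$, let $\mathcal E$ be a differential field extension of $\mathcal F$ (for instance a universal one), and write $a^{(k)}=\delta^k(a)$. For $f\in\mathcal F\{y_1,\dots,y_n\}=\mathcal F[y_j^{(k)}:1\le j\le n,\ k\ge 0]$ let $\operatorname{ord}_{y_j}f$ be the largest $k$ such that $y_j^{(k)}$ appears effectively in $f$, with $\operatorname{ord}_{y_j}f=-\infty$ if no derivative of $y_j$ (including $y_j$ itself) appears. If $P,Q\in\mathcal F\{u\}$ with $Q\neq0$ and $\gcd(P,Q)=1$, put $\operatorname{ord}(P/Q)=\max\{\operatorname{ord}_uP,\operatorname{ord}_uQ\}$. For a subset $S$ of $\mathcal E$ let $\mathcal F\langle S\rangle$ be the field generated over $\mathcal F$ by all derivatives $a^{(k)}$, $a\in S$, $k\ge 0$. Let $A\in\mathcal F\{x,y\}$ be an irreducible differential polynomial. Fix a ranking, i.e. a total order $<$ on the derivatives $x^{(k)},y^{(k)}$ such that $v<\delta v$, and $v<w$ implies $\delta v<\delta w$. Let $v_A$ be the highest ranked derivative appearing in $A$, let $I_A$ be the leading coefficient of $A$ as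 a polynomial in $v_A$ and $S_A=\partial A/\partial v_A$, let $[A]$ be the differential ideal generated by $A$, and let $$\operatorname{sat}(A)=\{f\in\mathcal F\{x,y\}:\ (S_AI_A)^m f\in[A]\ \text{for some } m\in\mathbb N\}.$$ Let $\mathcal C\subset\mathcal E^2$ be the differential curve defined by $A$, i.e. the set of common differential zeros of $\operatorname{sat}(A)$. **Theorem 3.1.** Suppose that $(\mathcal C,A)$ is unirational with a proper differential rational parametrization $\left(\frac{P_1(u)}{Q_1(u)},\frac{P_2(u)}{Q_2(u)}\right)$. That is, $u\in\mathcal E$ is differentially transcendental over $\mathcal F$ (its derivatives $u,u',u'',\dots$ are algebraically independent over $\mathcal F$); $P_i,Q_i\in\mathcal F\{u\}$, $Q_i\ne0$ and $\gcd(P_i,Q_i)=1$ for $i=1,2$; the point $\left(\frac{P_1(u)}{Q_1(u)},\frac{P_2(u)}{Q_2(u)}\right)$ is a generic point of $\mathcal C$, i.e. the set of all $f\in\mathcal F\{x,y\}$ that vanish at it is exactly $\operatorname{sat}(A)$; and $$\mathcal F\left\langle \tfrac{P_1(u)}{Q_1(u)},\tfrac{P_2(u)}{Q_2(u)}\right\rangle=\mathcal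 F\langle u\rangle .$$ Then $$\operatorname{ord}\left(\frac{P_1(u)}{Q_1(u)}\right)=\operatorname{ord}_yA,\qquad \operatorname{ord}\left(\frac{P_2(u)}{Q_2(u)}\right)=\operatorname{ord}_xA .$$ -/

import Mathlib

noncomputable section

namespace DiffCurve

open MvPolynomial

/-- The `k`-th derivative `a^{(k)}` of an element of a differential ring. -/
def iterDeriv {R : Type*} [CommRing R] [Differential R] (k : ℕ) (a : R) : R :=
  (⇑(Differential.deriv : Derivation ℤ R R))^[k] a

/-! ### Differential polynomials -/

/-- The differential polynomial ring `F{y_j : j ∈ σ} = F[y_j^{(k)} : j ∈ σ, k ∈ ℕ]`.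
The variable with index `(j, k)` is `y_j^{(k)}`. -/
abbrev DiffPoly (σ F : Type*) [CommRing F] : Type _ := MvPolynomial (σ × ℕ) F

section Derivation

variable {σ F : Type*} [CommRing F] [Differential F]

/-- Differentiation of the coefficients of a polynomial. -/
def coeffDeriv : DiffPoly σ F →+ DiffPoly σ F where
  toFun := AddMonoidAlgebra.map (Differential.deriv : Derivation ℤ F F).toLinearMap.toAddMonoidHom
  map_zero' := AddMonoidAlgebra.map_zero _
  map_add' := AddMonoidAlgebra.map_add _

theorem coeffDeriv_monomial (s : σ × ℕ →₀ ℕ) (a : F) :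
    coeffDeriv (monomial s a : DiffPoly σ F) = monomial s (Differential.deriv a) :=
  AddMonoidAlgebra.map_single _ _ _

theorem coeffDeriv_mul (p q : DiffPoly σ F) :
    coeffDeriv (p * q) = p * coeffDeriv q + q * coeffDeriv p := by
  induction p using MvPolynomial.induction_on' with
  | add p₁ p₂ h₁ h₂ => rw [add_mul, map_add, h₁, h₂, map_add]; ring
  | monomial s a =>
    induction q using MvPolynomial.induction_on' with
    | add q₁ q₂ h₁ h₂ => rw [mul_add, map_add, h₁, h₂, map_add]; ring
    | monomial t b =>
      simp only [monomial_mul, coeffDeriv_monomial, Derivation.leibniz, smul_eq_mul, map_add]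
      rw [add_comm t s]

/-- The derivation of `F{y_j : j ∈ σ}`: the unique one that extends the derivation of `F` and sends
`y_j^{(k)}` to `y_j^{(k+1)}`. -/
instance : Differential (DiffPoly σ F) where
  deriv := Derivation.mk' (coeffDeriv (σ := σ) (F := F)).toIntLinearMap coeffDeriv_mul +
    (mkDerivation F fun v : σ × ℕ => (X (v.1, v.2 + 1) : DiffPoly σ F)).restrictScalars ℤ

theorem deriv_eq (p : DiffPoly σ F) :
    Differential.deriv p = coeffDeriv p +
      mkDerivation F (fun v : σ × ℕ => (X (v.1, v.2 + 1) : DiffPoly σ F)) p :=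
  rfl

theorem deriv_X (v : σ × ℕ) :
    Differential.deriv (X v : DiffPoly σ F) = X (v.1, v.2 + 1) := by
  have h : coeffDeriv (X v : DiffPoly σ F) = 0 := by
    rw [X, coeffDeriv_monomial, Derivation.map_one_eq_zero, monomial_zero]
  rw [deriv_eq, mkDerivation_X, h, zero_add]

theorem deriv_C (a : F) :
    Differential.deriv (C a : DiffPoly σ F) = C (Differential.deriv a) := by
  rw [deriv_eq, derivation_C, add_zero]
  exact coeffDeriv_monomial 0 a

end Derivation

/-- The order `ord_{y_j} f ∈ ℕ ∪ {-∞}`: the largest `k` such that `y_j^{(k)}` appears effectively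
in `f`, and `-∞ = ⊥` if no derivative of `y_j` appears in `f`. -/
def ord {σ F : Type*} [DecidableEq σ] [CommRing F] (j : σ) (f : DiffPoly σ F) : WithBot ℕ :=
  (f.vars.filter fun v => v.1 = j).sup fun v => (v.2 : WithBot ℕ)

/-- The order of a differential rational function that is written in reduced form `P(u) / Q(u)`
(with `gcd(P, Q) = 1`): the maximum of `ord_u P` and `ord_u Q`. -/
def ordFrac {F : Type*} [CommRing F] (P Q : DiffPoly Unit F) : WithBot ℕ :=
  max (ord () P) (ord () Q)

/-- The value `f(η)` of a differential polynomial `f` at a point `η` with coordinates in a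
differential extension `E` of `F`: `y_j^{(k)}` is replaced by `η_j^{(k)}`. -/
def evalAt {σ F E : Type*} [CommRing F] [CommRing E] [Differential E] [Algebra F E]
    (η : σ → E) : DiffPoly σ F →ₐ[F] E :=
  aeval fun v : σ × ℕ => iterDeriv v.2 (η v.1)

/-! ### Differential ideals and differential varieties -/

/-- The differential ideal `[S]`: the ideal generated by all derivatives of the elements of `S`. -/
def diffIdeal {R : Type*} [CommRing R] [Differential R] (S : Set R) : Ideal R :=
  Ideal.span {g | ∃ f ∈ S, ∃ k : ℕ, g = iterDeriv k f}

/-- `[S]` is closed under the derivation. -/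
theorem deriv_mem_diffIdeal {R : Type*} [CommRing R] [Differential R] (S : Set R) {f : R}
    (hf : f ∈ diffIdeal S) : Differential.deriv f ∈ diffIdeal S := by
  induction hf using Submodule.span_induction with
  | mem g hg =>
    obtain ⟨f, hf, k, rfl⟩ := hg
    exact Ideal.subset_span ⟨f, hf, k + 1, by simp [iterDeriv, Function.iterate_succ_apply']⟩
  | zero => simp
  | add a b _ _ ha hb => rw [map_add]; exact add_mem ha hb
  | smul c a h ha =>
    rw [smul_eq_mul, Derivation.leibniz, smul_eq_mul, smul_eq_mul]
    exact add_mem (Ideal.mul_mem_left _ _ ha) (Ideal.mul_mem_right _ _ h)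

/-- The differential variety `𝕍(S)`: the differential zeros of `S` in the affine space over `E`. -/
def zeroLocus {σ F : Type*} (E : Type*) [CommRing F] [CommRing E] [Differential E] [Algebra F E]
    (S : Set (DiffPoly σ F)) : Set (σ → E) :=
  {η | ∀ f ∈ S, evalAt η f = 0}

/-- The ideal `𝕀(η)` of all differential polynomials over `F` that vanish at the point `η`. -/
def idealOf {σ E : Type*} (F : Type*) [CommRing F] [CommRing E] [Differential E] [Algebra F E]
    (η : σ → E) : Ideal (DiffPoly σ F) :=
  RingHom.ker (evalAt (F := F) η)

/-! ### Rankings, leaders, and the saturation ideal -/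

/-- A ranking on the derivatives `y_j^{(k)}`: a total ordering such that `v < δv`, and
`v < w` implies `δv < δw`. -/
structure Ranking (σ : Type*) where
  /-- The strict ordering. -/
  lt : σ × ℕ → σ × ℕ → Prop
  isStrictTotalOrder : IsStrictTotalOrder (σ × ℕ) lt
  lt_deriv : ∀ v : σ × ℕ, lt v (v.1, v.2 + 1)
  deriv_lt_deriv : ∀ v w : σ × ℕ, lt v w → lt (v.1, v.2 + 1) (w.1, w.2 + 1)

/-- `v` is the leader of `A`: the highest ranked derivative that appears in `A`. -/
def Ranking.IsLeader {σ F : Type*} [CommRing F] (r : Ranking σ) (A : DiffPoly σ F)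
    (v : σ × ℕ) : Prop :=
  v ∈ A.vars ∧ ∀ w ∈ A.vars, w ≠ v → r.lt w v

/-- The coefficient of `v ^ d` in `A`, where `d` is the degree of `A` in `v`. For the leader `v`
this is the initial of `A`. -/
def initialAt {σ F : Type*} [CommRing F] (A : DiffPoly σ F) (v : σ × ℕ) : DiffPoly σ F :=
  ∑ s ∈ A.support with s v = A.degreeOf v, monomial (s.erase v) (A.coeff s)

/-- The partial derivative `∂A/∂v`. For the leader `v` this is the separant of `A`. -/
def separantAt {σ F : Type*} [CommRing F] (A : DiffPoly σ F) (v : σ × ℕ) : DiffPoly σ F :=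
  pderiv v A

/-- The saturation ideal `sat(A) = [A] : (S_A I_A)^∞` with respect to the ranking `r`, where `S_A`
is the separant and `I_A` is the initial of `A`. (`A` is meant to be nonconstant, so that it has a
leader.) -/
def sat {σ F : Type*} [CommRing F] [Differential F] (r : Ranking σ) (A : DiffPoly σ F) :
    Set (DiffPoly σ F) :=
  {f | ∃ v, r.IsLeader A v ∧
    ∃ m : ℕ, (separantAt A v * initialAt A v) ^ m * f ∈ diffIdeal {A}}

/-! ### Differential fields -/

section Fields

variable (F : Type*) {E : Type*} [Field F] [Field E] [Differential E] [Algebra F E]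

/-- The differential subfield `F⟨S⟩` of `E` generated by `S` over `F`, that is, the field generated
over `F` by all derivatives of the elements of `S`. -/
def diffAdjoin (S : Set E) : IntermediateField F E :=
  IntermediateField.adjoin F {z | ∃ a ∈ S, ∃ k : ℕ, z = iterDeriv k a}

/-- `u` is differentially transcendental over `F`. -/
def DiffTranscendental (u : E) : Prop :=
  AlgebraicIndependent F fun k : ℕ => iterDeriv k u

end Fields

/-! ### Plane differential curves and their parametrizations -/

section Curves

variable {F E : Type*} [Field F] [Differential F] [Field E] [Differential E] [Algebra F E]

/-- `C` is the irreducible plane differential curve `(C, A)` defined by `A ∈ F{x, y}`: the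
differential polynomial `A` is irreducible and `C` is its general component `𝕍(sat(A))`.
The coordinates `x` and `y` have the indices `0` and `1`. -/
structure IsCurve (r : Ranking (Fin 2)) (C : Set (Fin 2 → E)) (A : DiffPoly (Fin 2) F) :
    Prop where
  irreducible : Irreducible A
  eq_zeroLocus : C = zeroLocus E (sat r A)

/-- The point `𝒫(u) = (P₁(u) / Q₁(u), P₂(u) / Q₂(u))`. -/
def paramPoint (u : E) (P Q : Fin 2 → DiffPoly Unit F) : Fin 2 → E :=
  fun i => evalAt (fun _ => u) (P i) / evalAt (fun _ => u) (Q i)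

/-- `𝒫(u) = (P₁(u) / Q₁(u), P₂(u) / Q₂(u))`, in reduced form, is a differential rational
parametrization of the curve `(C, A)`: the parameter `u` is differentially transcendental over `F`
and `𝒫(u)` is a generic point of the ideal `sat(A)` that defines `C`, that is, `𝕀(𝒫(u)) = sat(A)`.
(The curve is called unirational if it has such a parametrization.) -/
structure IsRationalParametrization (r : Ranking (Fin 2)) (C : Set (Fin 2 → E))
    (A : DiffPoly (Fin 2) F) (u : E) (P Q : Fin 2 → DiffPoly Unit F) : Prop where
  isCurve : IsCurve r C A
  diffTranscendental : DiffTranscendental F u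
  den_ne_zero : ∀ i, Q i ≠ 0
  reduced : ∀ i, IsRelPrime (P i) (Q i)
  generic : (idealOf F (paramPoint u P Q) : Set (DiffPoly (Fin 2) F)) = sat r A

/-- Properness of a parametrization: `F⟨P₁(u) / Q₁(u), P₂(u) / Q₂(u)⟩ = F⟨u⟩`. -/
def IsProper (u : E) (P Q : Fin 2 → DiffPoly Unit F) : Prop :=
  diffAdjoin F (Set.range (paramPoint u P Q)) = diffAdjoin F {u}

end Curves

end DiffCurve

end

noncomputable section

namespace DiffCurve

open MvPolynomial

/-! ### A multivariate polynomial as a polynomial in one of its variables -/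

section ToPoly

variable {σ F : Type*} [DecidableEq σ] [Field F]

/-- A polynomial, regarded as a univariate polynomial in the variable `v`. -/
def toPoly (v : σ) : MvPolynomial σ F →ₐ[F] Polynomial (MvPolynomial σ F) :=
  aeval fun w => if w = v then Polynomial.X else Polynomial.C (X w)

theorem eval_toPoly (v : σ) (f : MvPolynomial σ F) : (toPoly v f).eval (X v) = f := by
  have h : ((Polynomial.aeval (X v : MvPolynomial σ F)).restrictScalars F).comp (toPoly v) =
      AlgHom.id F (MvPolynomial σ F) := by
    ext w : 1
    by_cases hw : w = v <;> simp [toPoly, hw]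
  exact DFunLike.congr_fun h f

theorem toPoly_ne_zero (v : σ) {f : MvPolynomial σ F} (hf : f ≠ 0) : toPoly v f ≠ 0 := by
  intro h
  have := eval_toPoly v f
  rw [h, Polynomial.eval_zero] at this
  exact hf this.symm

theorem coeff_toPoly_mem_supported (v : σ) {s : Set σ} {f : MvPolynomial σ F}
    (hf : f ∈ supported F s) (n : ℕ) : (toPoly v f).coeff n ∈ supported F (s \ {v}) := by
  rw [supported_eq_adjoin_X] at hf
  induction hf using Algebra.adjoin_induction generalizing n with
  | mem g hg =>
    obtain ⟨w, hw, rfl⟩ := hg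
    by_cases h : w = v
    · simp only [toPoly, aeval_X, h, if_true, Polynomial.coeff_X]
      split_ifs
      exacts [one_mem _, zero_mem _]
    · simp only [toPoly, aeval_X, h, if_false, Polynomial.coeff_C]
      split_ifs
      exacts [X_mem_supported.2 ⟨hw, h⟩, zero_mem _]
  | algebraMap c =>
    rw [AlgHom.commutes, Polynomial.algebraMap_apply, Polynomial.coeff_C]
    split_ifs
    exacts [Subalgebra.algebraMap_mem _ c, zero_mem _]
  | add f g _ _ hf hg =>
    rw [map_add, Polynomial.coeff_add]
    exact add_mem (hf n) (hg n)
  | mul f g _ _ hf hg =>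
    rw [map_mul, Polynomial.coeff_mul]
    exact sum_mem fun x _ => mul_mem (hf _) (hg _)

theorem eval_map_toPoly {B : Type*} [CommRing B] [Algebra F B] (φ : MvPolynomial σ F →ₐ[F] B)
    (v : σ) (f : MvPolynomial σ F) :
    ((toPoly v f).map (φ : MvPolynomial σ F →+* B)).eval (φ (X v)) = φ f := by
  conv_rhs => rw [← eval_toPoly v f]
  exact Polynomial.eval_map_apply (f := (φ : MvPolynomial σ F →+* B)) (X v)

end ToPoly

/-! ### Divisibility and variables -/

section Vars

variable {σ F : Type*} [Field F]

theorem vars_subset_of_dvd {f g : MvPolynomial σ F} (h : f ∣ g) (hg : g ≠ 0) :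
    f.vars ⊆ g.vars := by
  obtain ⟨k, rfl⟩ := h
  intro v hv
  rw [mem_vars_iff_degreeOf_ne_zero] at hv ⊢
  rw [degreeOf_mul_eq (left_ne_zero_of_mul hg) (right_ne_zero_of_mul hg)]
  omega

theorem pderiv_mem_supported {s : Set σ} {f : MvPolynomial σ F} (hf : f ∈ supported F s) (v : σ) :
    pderiv v f ∈ supported F s := by
  classical
  rw [supported_eq_adjoin_X] at hf
  induction hf using Algebra.adjoin_induction with
  | mem g hg =>
    obtain ⟨w, hw, rfl⟩ := hg
    rw [pderiv_X, Pi.single_apply]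
    split_ifs
    exacts [one_mem _, zero_mem _]
  | algebraMap c => simp
  | add f g _ _ hf hg => rw [map_add]; exact add_mem hf hg
  | mul f g hf hg hf' hg' =>
    rw [Derivation.leibniz, smul_eq_mul, smul_eq_mul]
    exact add_mem (mul_mem hf hg') (mul_mem hg hf')

theorem not_dvd_of_degreeOf_lt {f g : MvPolynomial σ F} {v : σ} (hg : g ≠ 0)
    (h : g.degreeOf v < f.degreeOf v) : ¬ f ∣ g := by
  rintro ⟨k, rfl⟩
  rw [degreeOf_mul_eq (left_ne_zero_of_mul hg) (right_ne_zero_of_mul hg)] at h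
  omega

theorem not_dvd_of_mem_supported {f g : MvPolynomial σ F} {v : σ} {s : Set σ} (hg : g ≠ 0)
    (hf : v ∈ f.vars) (hgs : g ∈ supported F s) (hv : v ∉ s) : ¬ f ∣ g :=
  fun h => hv (mem_supported.1 hgs (vars_subset_of_dvd h hg hf))

theorem exists_mem_support_eq_degreeOf {f : MvPolynomial σ F} (hf : f ≠ 0) (v : σ) :
    ∃ s ∈ f.support, s v = f.degreeOf v := by
  obtain ⟨s, hs, h⟩ := Finset.exists_mem_eq_sup f.support (support_nonempty.2 hf) fun m => m v
  exact ⟨s, hs, by rw [degreeOf_eq_sup, h]⟩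

theorem ne_zero_of_mem_vars {f : MvPolynomial σ F} {v : σ} (hv : v ∈ f.vars) : f ≠ 0 := by
  rintro rfl
  simp at hv

theorem not_dvd_pderiv [CharZero F] {f : MvPolynomial σ F} {v : σ} (hv : v ∈ f.vars) :
    ¬ f ∣ pderiv v f := by
  have hd := mem_vars_iff_degreeOf_ne_zero.1 hv
  obtain ⟨s, hs, hsv⟩ := exists_mem_support_eq_degreeOf (ne_zero_of_mem_vars hv) v
  have h0 : pderiv v f ≠ 0 := by
    intro h
    have h1 := coeff_pderiv (i := v) f (s - Finsupp.single v 1)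
    have hle : Finsupp.single v 1 ≤ s := by
      rw [Finsupp.single_le_iff]
      omega
    rw [h, coeff_zero, tsub_add_cancel_of_le hle] at h1
    refine mul_ne_zero (mem_support_iff.1 hs) ?_ h1.symm
    exact Nat.cast_add_one_ne_zero _
  refine not_dvd_of_degreeOf_lt (v := v) h0 ?_
  rw [degreeOf_lt_iff (Nat.pos_of_ne_zero hd)]
  intro m hm
  rw [mem_support_iff, coeff_pderiv] at hm
  have := monomial_le_degreeOf v (mem_support_iff.2 (left_ne_zero_of_mul hm))
  simp only [Finsupp.add_apply, Finsupp.single_eq_same] at this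
  omega

theorem initialAt_mem_supported {A : DiffPoly σ F} (v : σ × ℕ)
    {s : Set (σ × ℕ)} (hA : A ∈ supported F s) : initialAt A v ∈ supported F (s \ {v}) := by
  classical
  refine sum_mem fun m hm => ?_
  have hm := (Finset.mem_filter.1 hm).1
  rw [mem_supported, vars_monomial (mem_support_iff.1 hm), Finsupp.support_erase]
  intro w hw
  rw [Finset.mem_coe, Finset.mem_erase] at hw
  exact ⟨mem_supported.1 hA ((mem_vars_iff_mem_support w).2 ⟨m, hm, hw.2⟩), hw.1⟩

theorem initialAt_ne_zero {A : DiffPoly σ F} (hA : A ≠ 0) (v : σ × ℕ) : initialAt A v ≠ 0 := by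
  classical
  obtain ⟨s, hs, hsv⟩ := exists_mem_support_eq_degreeOf hA v
  intro h
  have h1 : (initialAt A v).coeff (s.erase v) = A.coeff s := by
    rw [initialAt, coeff_sum, Finset.sum_eq_single s]
    · rw [coeff_monomial, if_pos rfl]
    · intro t ht hts
      rw [coeff_monomial, if_neg]
      intro h
      refine hts (Finsupp.ext fun w => ?_)
      by_cases hw : w = v
      · rw [hw, (Finset.mem_filter.1 ht).2, hsv]
      · simpa [Finsupp.erase_ne hw] using DFunLike.congr_fun h w
    · intro h
      exact absurd (Finset.mem_filter.2 ⟨hs, hsv⟩) h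
  rw [h, coeff_zero] at h1
  exact mem_support_iff.1 hs h1.symm

theorem not_dvd_initialAt {A : DiffPoly σ F} {v : σ × ℕ} (hv : v ∈ A.vars) :
    ¬ A ∣ initialAt A v :=
  not_dvd_of_mem_supported (initialAt_ne_zero (ne_zero_of_mem_vars hv) v) hv
    (initialAt_mem_supported v (mem_supported_vars A)) fun h => h.2 rfl

end Vars

/-! ### Reduction modulo an irreducible differential polynomial -/

section Reduction

variable {σ F : Type*}

/-- The derivatives `y_i^{(k)}` with no restriction on `k` for `i ≠ j`, and with `k ≤ n` for
`i = j`. -/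
def ordLE (j : σ) (n : ℕ) : Set (σ × ℕ) := {w | w.1 = j → w.2 ≤ n}

theorem ordLE_mono (j : σ) {m n : ℕ} (h : m ≤ n) : ordLE j m ⊆ ordLE j n :=
  fun _ hw hj => (hw hj).trans h

theorem iterDeriv_succ {R : Type*} [CommRing R] [Differential R] (k : ℕ) (a : R) :
    iterDeriv (k + 1) a = Differential.deriv (iterDeriv k a) :=
  Function.iterate_succ_apply' _ _ _

theorem Ranking.lt_of_lt (r : Ranking σ) (j : σ) {m n : ℕ} (h : m < n) : r.lt (j, m) (j, n) := by
  have := r.isStrictTotalOrder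
  induction n, h using Nat.le_induction with
  | base => exact r.lt_deriv (j, m)
  | succ n _ ih => exact _root_.trans ih (r.lt_deriv (j, n))

theorem Ranking.IsLeader.mem_supported_ordLE [Field F] {r : Ranking σ} {A : DiffPoly σ F} {v : σ × ℕ}
    (h : r.IsLeader A v) : A ∈ supported F (ordLE v.1 v.2) := by
  have := r.isStrictTotalOrder
  refine mem_supported.2 fun w hw hj => not_lt.1 fun hlt => ?_
  have h1 : r.lt v w := by
    have := r.lt_of_lt v.1 hlt
    rwa [← hj, Prod.mk.eta, hj, Prod.mk.eta] at this
  exact irrefl v (_root_.trans h1 (h.2 w hw fun h => by rw [h] at hlt; exact lt_irrefl _ hlt))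

variable [Field F] [Differential F]

theorem deriv_mem_supported_ordLE {j : σ} {n : ℕ} {f : DiffPoly σ F}
    (hf : f ∈ supported F (ordLE j n)) :
    Differential.deriv f ∈ supported F (ordLE j (n + 1)) := by
  have hle := supported_mono (R := F) (ordLE_mono j n.le_succ)
  rw [supported_eq_adjoin_X] at hf
  induction hf using Algebra.adjoin_induction with
  | mem g hg =>
    obtain ⟨w, hw, rfl⟩ := hg
    rw [deriv_X, X_mem_supported]
    exact fun h => Nat.succ_le_succ (hw h)
  | algebraMap c =>
    rw [algebraMap_eq, deriv_C]
    exact Subalgebra.algebraMap_mem _ _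
  | add f g _ _ hf hg => rw [map_add]; exact add_mem hf hg
  | mul f g hf hg hf' hg' =>
    rw [Derivation.leibniz, smul_eq_mul, smul_eq_mul]
    exact add_mem (mul_mem (hle hf) hg') (mul_mem (hle hg) hf')

theorem deriv_sub_pderiv_mul_mem {j : σ} {n : ℕ} {f : DiffPoly σ F}
    (hf : f ∈ supported F (ordLE j n)) :
    Differential.deriv f - pderiv (j, n) f * X (j, n + 1) ∈ supported F (ordLE j n) := by
  classical
  rw [supported_eq_adjoin_X] at hf
  induction hf using Algebra.adjoin_induction with
  | mem g hg =>
    obtain ⟨w, hw, rfl⟩ := hg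
    rw [deriv_X, pderiv_X, Pi.single_apply]
    split_ifs with h
    · rw [h, one_mul, sub_self]
      exact zero_mem _
    · rw [zero_mul, sub_zero, X_mem_supported]
      intro hj
      refine Nat.succ_le_of_lt (lt_of_le_of_ne (hw hj) fun h' => h ?_)
      exact Prod.ext hj h'
  | algebraMap c =>
    rw [algebraMap_eq, deriv_C, pderiv_C, zero_mul, sub_zero]
    exact Subalgebra.algebraMap_mem _ _
  | add f g _ _ hf hg =>
    rw [map_add, map_add]
    convert add_mem hf hg using 1
    ring
  | mul f g hf hg hf' hg' =>
    rw [Derivation.leibniz, Derivation.leibniz]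
    simp only [smul_eq_mul]
    rw [← supported_eq_adjoin_X] at hf hg
    convert add_mem (mul_mem hf hg') (mul_mem hg hf') using 1
    ring

/-- A proper derivative of `A` is linear in its highest derivative of `y_j`, with the separant as
the coefficient. -/
theorem iterDeriv_sub_pderiv_mul_mem {j : σ} {q : ℕ} {A : DiffPoly σ F}
    (hA : A ∈ supported F (ordLE j q)) (k : ℕ) :
    iterDeriv (k + 1) A - pderiv (j, q) A * X (j, q + k + 1) ∈
      supported F (ordLE j (q + k)) := by
  induction k with
  | zero => exact deriv_sub_pderiv_mul_mem hA
  | succ k ih =>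
    have h1 := deriv_mem_supported_ordLE ih
    rw [map_sub, ← iterDeriv_succ, Derivation.leibniz, deriv_X, smul_eq_mul, smul_eq_mul] at h1
    dsimp only at h1
    have hS : Differential.deriv (pderiv (j, q) A) ∈ supported F (ordLE j (q + k + 1)) :=
      supported_mono (ordLE_mono j (by omega)) (deriv_mem_supported_ordLE
        (pderiv_mem_supported hA (j, q)))
    have hX : (X (j, q + k + 1) : DiffPoly σ F) ∈ supported F (ordLE j (q + k + 1)) :=
      X_mem_supported.2 fun _ => le_rfl
    have h2 := add_mem h1 (mul_mem hX hS)
    rwa [sub_add_eq_sub_sub, sub_add_cancel] at h2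

/-- A homomorphism that is `φ` on the polynomials of order at most `q` in `y_j` and that kills
the first derivatives of `A`. -/
theorem exists_algHom_iterDeriv_eq_zero {K : Type*} [Field K] [Algebra F K] {j : σ} {q : ℕ}
    {A : DiffPoly σ F} (hA : A ∈ supported F (ordLE j q)) (φ : DiffPoly σ F →ₐ[F] K)
    (hφ : φ A = 0) (hS : φ (pderiv (j, q) A) ≠ 0) (N : ℕ) :
    ∃ ψ : DiffPoly σ F →ₐ[F] K, (∀ f ∈ supported F (ordLE j q), ψ f = φ f) ∧
      ∀ k ≤ N, ψ (iterDeriv k A) = 0 := by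
  classical
  induction N with
  | zero =>
    refine ⟨φ, fun _ _ => rfl, fun k hk => ?_⟩
    rw [Nat.le_zero.1 hk]
    exact hφ
  | succ N ih =>
    obtain ⟨ψ, hψ, hk⟩ := ih
    set T := iterDeriv (N + 1) A - pderiv (j, q) A * X (j, q + N + 1) with hT
    let χ : DiffPoly σ F →ₐ[F] K := aeval (Function.update (fun w => ψ (X w)) (j, q + N + 1)
      (-ψ T / ψ (pderiv (j, q) A)))
    have hχ : ∀ f ∈ supported F (ordLE j (q + N)), χ f = ψ f := by
      intro f hf
      conv_rhs => rw [aeval_unique ψ]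
      refine eval₂Hom_congr' rfl (fun w hw _ => ?_) rfl
      rw [Function.update_of_ne]
      · rfl
      · rintro rfl
        have := mem_supported.1 hf hw rfl
        simp only at this
        omega
    have hle := supported_mono (R := F) (ordLE_mono j (Nat.le_add_right q N))
    have hSm := pderiv_mem_supported hA (j, q)
    have hder : ∀ k ≤ N, iterDeriv k A ∈ supported F (ordLE j (q + k)) := by
      intro k _
      clear * - hA
      induction k with
      | zero => exact hA
      | succ k ih =>
        rw [iterDeriv_succ]
        exact deriv_mem_supported_ordLE ih
    refine ⟨χ, fun f hf => (hχ f (hle hf)).trans (hψ f hf), fun k hk' => ?_⟩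
    rcases Nat.le_succ_iff.1 hk' with h | rfl
    · rw [hχ _ (supported_mono (ordLE_mono j (by omega)) (hder k h)), hk k h]
    · have h1 : iterDeriv (N + 1) A = T + pderiv (j, q) A * X (j, q + N + 1) := by
        rw [hT]; ring
      have h2 : χ (X (j, q + N + 1)) = -ψ T / ψ (pderiv (j, q) A) := by
        rw [aeval_X, Function.update_self]
      rw [h1, map_add, map_mul, h2, hχ _ (hle hSm), hχ _ (iterDeriv_sub_pderiv_mul_mem hA N),
        mul_div_cancel₀ _ (by rwa [hψ _ hSm]), add_neg_cancel]

/-- An element of the saturation ideal of `A` that has at most the order of `A` in the leading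
variable is divisible by `A`. -/
theorem dvd_of_pow_mul_mem_diffIdeal [CharZero F] {j : σ} {q : ℕ} {A f : DiffPoly σ F}
    (hirr : Irreducible A) (hA : A ∈ supported F (ordLE j q)) (hv : (j, q) ∈ A.vars)
    (hf : f ∈ supported F (ordLE j q)) {m : ℕ}
    (h : (separantAt A (j, q) * initialAt A (j, q)) ^ m * f ∈ diffIdeal {A}) : A ∣ f := by
  have hprime : (Ideal.span {A}).IsPrime :=
    (Ideal.span_singleton_prime hirr.ne_zero).2 hirr.prime
  let K := FractionRing (DiffPoly σ F ⧸ Ideal.span {A})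
  let φ : DiffPoly σ F →ₐ[F] K :=
    (IsScalarTower.toAlgHom F (DiffPoly σ F ⧸ Ideal.span {A}) K).comp (Ideal.Quotient.mkₐ F _)
  have hφ : ∀ g, φ g = 0 ↔ A ∣ g := by
    intro g
    rw [← Ideal.mem_span_singleton, ← Ideal.Quotient.eq_zero_iff_mem]
    exact map_eq_zero_iff _ (IsFractionRing.injective (DiffPoly σ F ⧸ Ideal.span {A}) K)
  have key : ∀ g ∈ diffIdeal {A}, ∃ N, ∀ ψ : DiffPoly σ F →ₐ[F] K,
      (∀ k ≤ N, ψ (iterDeriv k A) = 0) → ψ g = 0 := by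
    intro g hg
    induction hg using Submodule.span_induction with
    | mem g hg =>
      obtain ⟨_, rfl, k, rfl⟩ := hg
      exact ⟨k, fun ψ h => h k le_rfl⟩
    | zero => exact ⟨0, fun ψ _ => map_zero ψ⟩
    | add a b _ _ ha hb =>
      obtain ⟨N, hN⟩ := ha
      obtain ⟨M, hM⟩ := hb
      refine ⟨max N M, fun ψ h => ?_⟩
      rw [map_add, hN ψ fun k hk => h k (hk.trans (le_max_left _ _)),
        hM ψ fun k hk => h k (hk.trans (le_max_right _ _)), add_zero]
    | smul c a _ ha =>
      obtain ⟨N, hN⟩ := ha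
      exact ⟨N, fun ψ h => by rw [smul_eq_mul, map_mul, hN ψ h, mul_zero]⟩
  obtain ⟨N, hN⟩ := key _ h
  have hS : φ (pderiv (j, q) A) ≠ 0 := fun h => not_dvd_pderiv hv ((hφ _).1 h)
  have hI : φ (initialAt A (j, q)) ≠ 0 := fun h => not_dvd_initialAt hv ((hφ _).1 h)
  obtain ⟨ψ, hψ, hk⟩ := exists_algHom_iterDeriv_eq_zero hA φ ((hφ A).2 dvd_rfl) hS N
  have h0 := hN ψ hk
  rw [map_mul, map_pow, map_mul, hψ _ hf, separantAt, hψ _ (pderiv_mem_supported hA _),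
    hψ _ (supported_mono Set.sdiff_subset (initialAt_mem_supported (j, q) hA))] at h0
  exact (hφ f).1 ((mul_eq_zero.1 h0).resolve_left (pow_ne_zero _ (mul_ne_zero hS hI)))

/-- Membership in `sat(A)` of a polynomial that has at most the order of `A` in the leading
variable amounts to divisibility by `A`. -/
theorem dvd_of_mem_sat [CharZero F] {r : Ranking σ} {A f : DiffPoly σ F} (hirr : Irreducible A)
    (hf : f ∈ sat r A) :
    ∃ v ∈ A.vars, A ∈ supported F (ordLE v.1 v.2) ∧
      (f ∈ supported F (ordLE v.1 v.2) → A ∣ f) := by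
  obtain ⟨v, hv, m, h⟩ := hf
  exact ⟨v, hv.1, hv.mem_supported_ordLE, fun hfs =>
    dvd_of_pow_mul_mem_diffIdeal hirr hv.mem_supported_ordLE hv.1 hfs h⟩

end Reduction

/-! ### Algebraic closure in a differential field -/

section Closure

variable (F : Type*) {E : Type*} [Field F] [Field E] [Algebra F E]

/-- The relative algebraic closure in `E` of the field generated by `S` over `F`. -/
def algCl (S : Set E) : IntermediateField F E :=
  (algebraicClosure (IntermediateField.adjoin F S) E).restrictScalars F

variable {F}

theorem mem_algCl {S : Set E} {z : E} :
    z ∈ algCl F S ↔ IsAlgebraic (IntermediateField.adjoin F S) z :=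
  mem_algebraicClosure_iff

theorem coe_algCl (S : Set E) :
    (algCl F S : Set E) = (AlgebraicIndependent.matroid F E).closure S := by
  ext z
  rw [AlgebraicIndependent.matroid_closure_eq, SetLike.mem_coe, SetLike.mem_coe, mem_algCl,
    Subalgebra.mem_algebraicClosure]
  open IntermediateField.algebraAdjoinAdjoin in
  exact (IsFractionRing.isAlgebraic_iff (Algebra.adjoin F S) (IntermediateField.adjoin F S) E).symm

theorem adjoin_le_algCl (S : Set E) : IntermediateField.adjoin F S ≤ algCl F S :=
  fun z hz => mem_algCl.2 (isAlgebraic_algebraMap (⟨z, hz⟩ : IntermediateField.adjoin F S))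

theorem subset_algCl (S : Set E) : S ⊆ algCl F S :=
  (IntermediateField.subset_adjoin F S).trans (adjoin_le_algCl S)

theorem algCl_mono {S T : Set E} (h : S ⊆ T) : algCl F S ≤ algCl F T := by
  rw [← SetLike.coe_subset_coe, coe_algCl, coe_algCl]
  exact (AlgebraicIndependent.matroid F E).closure_subset_closure h

theorem algCl_le {S T : Set E} (h : S ⊆ algCl F T) : algCl F S ≤ algCl F T := by
  rw [coe_algCl] at h
  rw [← SetLike.coe_subset_coe, coe_algCl, coe_algCl]
  exact (AlgebraicIndependent.matroid F E).closure_subset_closure_of_subset_closure h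

/-- A root of a nonzero polynomial with coefficients in the closure is in the closure. -/
theorem mem_algCl_of_root {S : Set E} {p : Polynomial E} (hp : p ≠ 0)
    (hc : ∀ n, p.coeff n ∈ algCl F S) {z : E} (hz : p.eval z = 0) : z ∈ algCl F S := by
  have h1 : IsAlgebraic (algCl F S) z := by
    have hl : p ∈ Polynomial.lifts (algebraMap (algCl F S) E) :=
      (Polynomial.lifts_iff_coeff_lifts p).2 fun n => ⟨⟨_, hc n⟩, rfl⟩
    obtain ⟨p', rfl⟩ := (Polynomial.mem_lifts p).1 hl
    refine ⟨p', ?_, ?_⟩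
    · rintro rfl
      simp at hp
    · rwa [Polynomial.aeval_def, ← Polynomial.eval_map]
  have h2 : IsAlgebraic (algebraicClosure (IntermediateField.adjoin F S) E) z := h1
  exact mem_algCl.2 (IsAlgebraic.restrictScalars (IntermediateField.adjoin F S) h2)

variable [Differential E]

/-- The set of the derivatives of the elements of a set. -/
def derivSet (S : Set E) : Set E := (fun z => Differential.deriv z) '' S

variable [Differential F] [DifferentialAlgebra F E]

theorem deriv_mem_of_mem_adjoin {S : Set E} {K : IntermediateField F E} (hS : S ⊆ K)
    (hS' : derivSet S ⊆ K) {z : E} (hz : z ∈ IntermediateField.adjoin F S) :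
    Differential.deriv z ∈ K := by
  have hle : IntermediateField.adjoin F S ≤ K := IntermediateField.adjoin_le_iff.2 hS
  induction hz using IntermediateField.adjoin_induction with
  | mem x hx => exact hS' ⟨x, hx, rfl⟩
  | algebraMap x =>
    rw [DifferentialAlgebra.deriv_algebraMap]
    exact K.algebraMap_mem _
  | add x y _ _ hx hy =>
    rw [map_add]
    exact add_mem hx hy
  | mul x y hx hy hx' hy' =>
    rw [Derivation.leibniz, smul_eq_mul, smul_eq_mul]
    exact add_mem (mul_mem (hle hx) hy') (mul_mem (hle hy) hx')
  | inv x hx hx' =>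
    rw [Derivation.leibniz_inv, smul_eq_mul]
    exact mul_mem (neg_mem (pow_mem (inv_mem (hle hx)) 2)) hx'

/-- The derivative of an element that is algebraic over `F(S)` is algebraic over `F(S, S')`. -/
theorem deriv_mem_algCl_union [CharZero F] {S : Set E} {z : E} (hz : z ∈ algCl F S) :
    Differential.deriv z ∈ algCl F (S ∪ derivSet S) := by
  set K := algCl F (S ∪ derivSet S) with hK
  have hSK : S ⊆ K := Set.subset_union_left.trans (subset_algCl _)
  have hSK' : derivSet S ⊆ K := Set.subset_union_right.trans (subset_algCl _)
  have hzK : z ∈ K := algCl_mono Set.subset_union_left hz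
  set k := IntermediateField.adjoin F S
  have hk : ∀ c : k, (c : E) ∈ K := fun c => IntermediateField.adjoin_le_iff.2 hSK c.2
  have key : ∀ p : Polynomial k, ∃ g ∈ K, Differential.deriv (Polynomial.aeval z p) =
      g + Polynomial.aeval z (Polynomial.derivative p) * Differential.deriv z := by
    intro p
    induction p using Polynomial.induction_on' with
    | add p q hp hq =>
      obtain ⟨g, hg, hp⟩ := hp
      obtain ⟨h, hh, hq⟩ := hq
      refine ⟨g + h, add_mem hg hh, ?_⟩
      simp only [map_add, hp, hq]
      ring
    | monomial n c =>
      refine ⟨z ^ n * Differential.deriv (c : E),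
        mul_mem (pow_mem hzK n) (deriv_mem_of_mem_adjoin hSK hSK' c.2), ?_⟩
      rw [Polynomial.aeval_monomial, Derivation.leibniz, Derivation.leibniz_pow,
        Polynomial.derivative_monomial, Polynomial.aeval_monomial]
      simp only [smul_eq_mul, nsmul_eq_mul, map_mul, map_natCast]
      change _ = z ^ n * Differential.deriv (algebraMap k E c) + _
      ring
  have halg := mem_algCl.1 hz
  have hsep : Polynomial.aeval z (Polynomial.derivative (minpoly k z)) ≠ 0 :=
    (minpoly.irreducible halg.isIntegral).separable.aeval_derivative_ne_zero (minpoly.aeval k z)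
  obtain ⟨g, hg, h⟩ := key (minpoly k z)
  rw [minpoly.aeval, map_zero] at h
  have h2 : Differential.deriv z =
      -g / Polynomial.aeval z (Polynomial.derivative (minpoly k z)) := by
    rw [eq_div_iff hsep]
    linear_combination -h
  rw [h2]
  refine div_mem (neg_mem hg) ?_
  rw [Polynomial.aeval_eq_sum_range]
  exact sum_mem fun i _ => by
    rw [Algebra.smul_def]
    exact mul_mem (hk _) (pow_mem hzK i)

theorem deriv_mem_algCl [CharZero F] {S T : Set E} (hS : S ⊆ algCl F T) (hS' : derivSet S ⊆ algCl F T) {z : E}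
    (hz : z ∈ algCl F S) : Differential.deriv z ∈ algCl F T :=
  algCl_le (Set.union_subset hS hS') (deriv_mem_algCl_union hz)

end Closure

/-! ### The algebraic matroid -/

section Matroid

/-- If `Z ∪ I` is independent and `I` is spanned by `Z ∪ J`, then `I` has at most as many elements
as `J`. -/
theorem encard_le_of_subset_closure_union {α : Type*} {M : Matroid α} {Z I J : Set α}
    (hdisj : Disjoint I Z) (hI : M.Indep (I ∪ Z)) (hsub : I ⊆ M.closure (J ∪ Z)) :
    I.encard ≤ J.encard := by
  have h1 : (M.contract Z).Indep I :=
    ((hI.subset Set.subset_union_right).contract_indep_iff).2 ⟨hdisj, hI⟩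
  have h2 : I ⊆ (M.contract Z).closure J := by
    rw [Matroid.contract_closure_eq]
    exact Set.subset_sdiff.2 ⟨hsub, hdisj⟩
  calc I.encard ≤ (M.contract Z).eRk ((M.contract Z).closure J) := h1.encard_le_eRk_of_subset h2
    _ ≤ J.encard := by
      rw [Matroid.eRk_closure_eq]
      exact Matroid.eRk_le_encard _ _

/-- A sequence in a finitary matroid none of whose terms is spanned by the earlier ones is
independent. -/
theorem indep_range_of_notMem_closure {α : Type*} {M : Matroid α} [M.Finitary] {w : ℕ → α}
    (hE : ∀ n, w n ∈ M.E) (h : ∀ n, w n ∉ M.closure (w '' Set.Iio n)) :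
    Function.Injective w ∧ M.Indep (Set.range w) := by
  have hind : ∀ n, M.Indep (w '' Set.Iio n) := by
    intro n
    induction n with
    | zero => simp
    | succ n ih =>
      have : Set.Iio (n + 1) = insert n (Set.Iio n) := by
        ext m
        simp only [Set.mem_Iio, Set.mem_insert_iff]
        omega
      rw [this, Set.image_insert_eq]
      exact ih.insert_indep_iff.2 (Or.inl ⟨hE n, h n⟩)
  constructor
  · have hne : ∀ m n, m < n → w m ≠ w n := fun m n hmn he => h n <| by
      rw [← he]
      exact M.mem_closure_of_mem' ⟨m, hmn, rfl⟩ (hE m)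
    intro m n he
    by_contra hmn
    rcases lt_or_gt_of_ne hmn with h' | h'
    exacts [hne m n h' he, hne n m h' he.symm]
  · rw [Matroid.indep_iff_forall_finite_subset_indep]
    intro J hJ hfin
    obtain ⟨b, hb⟩ := (hfin.image (Function.invFun w)).bddAbove
    refine (hind (b + 1)).subset fun x hx => ?_
    exact ⟨Function.invFun w x, Nat.lt_succ_of_le (hb ⟨x, hx, rfl⟩), Function.invFun_eq (hJ hx)⟩

end Matroid

/-! ### Orders and variables -/

section Ord

variable {σ F : Type*} [DecidableEq σ] [Field F] {j : σ} {f : DiffPoly σ F}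

theorem ord_le_coe_iff {n : ℕ} : ord j f ≤ n ↔ f ∈ supported F (ordLE j n) := by
  rw [ord, Finset.sup_le_iff, mem_supported]
  constructor
  · intro h w hw hj
    exact WithBot.coe_le_coe.1 (h w (Finset.mem_filter.2 ⟨hw, hj⟩))
  · intro h w hw
    exact WithBot.coe_le_coe.2 (h (Finset.mem_filter.1 hw).1 (Finset.mem_filter.1 hw).2)

theorem coe_le_ord {w : σ × ℕ} (hw : w ∈ f.vars) : (w.2 : WithBot ℕ) ≤ ord w.1 f :=
  Finset.le_sup (f := fun v : σ × ℕ => (v.2 : WithBot ℕ)) (Finset.mem_filter.2 ⟨hw, rfl⟩)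

theorem ord_eq_bot_iff : ord j f = ⊥ ↔ ∀ w ∈ f.vars, w.1 ≠ j := by
  rw [ord, Finset.sup_eq_bot_iff]
  constructor
  · intro h w hw hj
    exact WithBot.coe_ne_bot (h w (Finset.mem_filter.2 ⟨hw, hj⟩))
  · intro h w hw
    exact absurd (Finset.mem_filter.1 hw).2 (h w (Finset.mem_filter.1 hw).1)

theorem mem_vars_of_ord_eq {n : ℕ} (h : ord j f = n) : (j, n) ∈ f.vars := by
  have hne : (f.vars.filter fun v => v.1 = j).Nonempty := by
    rw [Finset.nonempty_iff_ne_empty]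
    intro he
    rw [ord, he, Finset.sup_empty] at h
    exact WithBot.bot_ne_coe h
  obtain ⟨w, hw, hws⟩ := Finset.exists_mem_eq_sup _ hne fun v => (v.2 : WithBot ℕ)
  obtain ⟨hw, rfl⟩ := Finset.mem_filter.1 hw
  have : w.2 = n := WithBot.coe_injective (hws.symm.trans h)
  rwa [← this, Prod.mk.eta]

theorem ord_eq_of_mem_vars {v : σ × ℕ} (hv : v ∈ f.vars)
    (h : f ∈ supported F (ordLE v.1 v.2)) : ord v.1 f = v.2 :=
  le_antisymm (ord_le_coe_iff.2 h) (coe_le_ord hv)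

end Ord

section EvalAt

variable {σ F E : Type*} [Field F] [Field E] [Differential E] [Algebra F E]

theorem evalAt_X (η : σ → E) (w : σ × ℕ) :
    evalAt (F := F) η (X w) = iterDeriv w.2 (η w.1) :=
  aeval_X _ _

theorem evalAt_mem {η : σ → E} {s : Set (σ × ℕ)} {K : IntermediateField F E}
    (hK : ∀ w ∈ s, iterDeriv w.2 (η w.1) ∈ K) {f : DiffPoly σ F} (hf : f ∈ supported F s) :
    evalAt η f ∈ K := by
  have h : (supported F s).map (evalAt η) ≤ K.toSubalgebra := by
    rw [supported_eq_adjoin_X, AlgHom.map_adjoin, Algebra.adjoin_le_iff]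
    rintro _ ⟨_, ⟨w, hw, rfl⟩, rfl⟩
    rw [evalAt_X]
    exact hK w hw
  exact h ⟨f, hf, rfl⟩

end EvalAt

/-- If `P / Q` is in reduced form and is equal to the quotient of the coefficients of each power of
`X v` in `P` and `Q`, then `X v` does not appear in it. -/
theorem notMem_vars_of_mul_coeff_eq {σ F : Type*} [DecidableEq σ] [Field F] {v : σ}
    {P Q : MvPolynomial σ F} (hQ : Q ≠ 0) (hPQ : IsRelPrime P Q)
    (h : ∀ k, P * (toPoly v Q).coeff k = Q * (toPoly v P).coeff k) :
    v ∉ P.vars ∧ v ∉ Q.vars := by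
  have hvars : ∀ (f : MvPolynomial σ F) (k : ℕ), v ∉ ((toPoly v f).coeff k).vars := fun f k hk =>
    (mem_supported.1 (coeff_toPoly_mem_supported v (mem_supported_vars f) k) hk).2 rfl
  obtain ⟨k, hk⟩ : ∃ k, (toPoly v Q).coeff k ≠ 0 := by
    by_contra! h
    exact toPoly_ne_zero v hQ (Polynomial.ext h)
  constructor
  · intro hv
    have hd : P ∣ (toPoly v P).coeff k := hPQ.dvd_of_dvd_mul_left ⟨_, (h k).symm⟩
    have h0 : (toPoly v P).coeff k ≠ 0 := by
      intro h0
      have h1 := h k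
      rw [h0, mul_zero] at h1
      exact mul_ne_zero (ne_zero_of_mem_vars hv) hk h1
    exact hvars P k (vars_subset_of_dvd hd h0 hv)
  · intro hv
    have hd : Q ∣ (toPoly v Q).coeff k := hPQ.symm.dvd_of_dvd_mul_left ⟨_, h k⟩
    exact hvars Q k (vars_subset_of_dvd hd hk hv)

/-! ### The order of a rational function of a differential transcendental -/

section Order

variable {F E : Type*} [Field F] [Field E] [Differential E] [Algebra F E] {u z : E} {a : ℕ}

/-- The derivatives of `u` of order less than `n`. -/
def derivsLT (u : E) (n : ℕ) : Set E := (fun k => iterDeriv k u) '' Set.Iio n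

theorem derivsLT_mono (u : E) {m n : ℕ} (h : m ≤ n) : derivsLT u m ⊆ derivsLT u n :=
  Set.image_mono (Set.Iio_subset_Iio h)

theorem derivSet_derivsLT_subset (u : E) (n : ℕ) :
    derivSet (derivsLT u n) ⊆ derivsLT u (n + 1) := by
  rintro _ ⟨_, ⟨k, hk, rfl⟩, rfl⟩
  exact ⟨k + 1, Nat.succ_lt_succ hk, iterDeriv_succ k u⟩

theorem encard_derivsLT_le (u : E) (n : ℕ) : (derivsLT u n).encard ≤ n := by
  refine (Set.encard_image_le _ _).trans_eq ?_
  rw [← Finset.coe_range, Set.encard_coe_eq_coe_finsetCard, Finset.card_range]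

variable (F) in
/-- `z` is algebraic over the field generated by the derivatives of `u` of order at most `a`, and
`u^{(a)}` is algebraic over the field generated by `z` and the derivatives of lower order. -/
structure HasOrder (u z : E) (a : ℕ) : Prop where
  mem_algCl : z ∈ algCl F (derivsLT u (a + 1))
  iterDeriv_mem_algCl : iterDeriv a u ∈ algCl F (insert z (derivsLT u a))

theorem DiffTranscendental.evalAt_injective (hu : DiffTranscendental F u) :
    Function.Injective (evalAt (F := F) fun _ : Unit => u) := by
  have : Function.Injective fun w : Unit × ℕ => w.2 := fun v w h => Prod.ext rfl h
  exact AlgebraicIndependent.comp hu _ this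

theorem DiffTranscendental.iterDeriv_notMem (hu : DiffTranscendental F u) (n : ℕ) :
    iterDeriv n u ∉ algCl F (derivsLT u n) := by
  have h : (AlgebraicIndependent.matroid F E).Indep (Set.range fun k => iterDeriv k u) :=
    AlgebraicIndependent.matroid_indep_iff.2 hu.coe_range
  have hinj : Function.Injective fun k => iterDeriv k u := hu.injective
  rw [← SetLike.mem_coe, coe_algCl]
  intro hn
  refine h.notMem_closure_sdiff_of_mem ⟨n, rfl⟩
    ((AlgebraicIndependent.matroid F E).closure_subset_closure ?_ hn)
  rintro _ ⟨k, hk, rfl⟩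
  exact ⟨⟨k, rfl⟩, fun h => (Set.mem_Iio.1 hk).ne (hinj h)⟩

theorem exists_eq_algebraMap_of_ordFrac_eq_bot {P Q : DiffPoly Unit F} (h : ordFrac P Q = ⊥) :
    ∃ c : F, evalAt (fun _ => u) P / evalAt (fun _ => u) Q = algebraMap F E c := by
  have hc : ∀ f : DiffPoly Unit F, ord () f = ⊥ → ∃ c : F, f = C c := by
    intro f hf
    refine ⟨f.coeff 0, vars_eq_empty_iff_eq_C.1 (Finset.eq_empty_of_forall_notMem fun w hw => ?_)⟩
    exact ord_eq_bot_iff.1 hf w hw rfl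
  obtain ⟨h1, h2⟩ := max_eq_bot.1 h
  obtain ⟨c, rfl⟩ := hc P h1
  obtain ⟨d, rfl⟩ := hc Q h2
  refine ⟨c / d, ?_⟩
  rw [map_div₀, ← algebraMap_eq, AlgHom.commutes, AlgHom.commutes]

theorem hasOrder_of_ordFrac_eq (hu : DiffTranscendental F u) {P Q : DiffPoly Unit F} (hQ : Q ≠ 0)
    (hPQ : IsRelPrime P Q) (h : ordFrac P Q = a) :
    HasOrder F u (evalAt (fun _ => u) P / evalAt (fun _ => u) Q) a := by
  set φ := evalAt (F := F) fun _ : Unit => u with hφ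
  have hinj : Function.Injective φ := hu.evalAt_injective
  have hPs : P ∈ supported F (ordLE () a) := ord_le_coe_iff.1 (h ▸ le_max_left _ _)
  have hQs : Q ∈ supported F (ordLE () a) := ord_le_coe_iff.1 (h ▸ le_max_right _ _)
  have hφQ : φ Q ≠ 0 := fun h0 => hQ (hinj (h0.trans (map_zero φ).symm))
  have hmem : ∀ w ∈ ordLE () a, iterDeriv w.2 u ∈ algCl F (derivsLT u (a + 1)) :=
    fun w hw => subset_algCl _ ⟨w.2, Nat.lt_succ_of_le (hw rfl), rfl⟩
  refine ⟨div_mem (evalAt_mem hmem hPs) (evalAt_mem hmem hQs), ?_⟩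
  set z := φ P / φ Q with hz
  set v : Unit × ℕ := ((), a) with hv
  set S := insert z (derivsLT u a)
  set G := (toPoly v P).map (φ : DiffPoly Unit F →+* E) -
    Polynomial.C z * (toPoly v Q).map (φ : DiffPoly Unit F →+* E) with hG
  have hcoeff : ∀ n, G.coeff n = φ ((toPoly v P).coeff n) - z * φ ((toPoly v Q).coeff n) := by
    intro n
    rw [hG, Polynomial.coeff_sub, Polynomial.coeff_C_mul, Polynomial.coeff_map,
      Polynomial.coeff_map]
    rfl
  have hlow : ∀ w ∈ ordLE () a \ {v}, iterDeriv w.2 u ∈ algCl F S := by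
    intro w hw
    refine subset_algCl _ (Or.inr ⟨w.2, lt_of_le_of_ne (hw.1 rfl) fun h => hw.2 ?_, rfl⟩)
    exact Prod.ext rfl h
  have hroot : G.eval (iterDeriv a u) = 0 := by
    have hX : φ (X v) = iterDeriv a u := evalAt_X _ _
    rw [hG, Polynomial.eval_sub, Polynomial.eval_mul, Polynomial.eval_C, ← hX, eval_map_toPoly,
      eval_map_toPoly, hz, div_mul_cancel₀ _ hφQ, sub_self]
  by_cases hG0 : G = 0
  · exfalso
    have h0 : ∀ n, φ ((toPoly v P).coeff n) = z * φ ((toPoly v Q).coeff n) := by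
      intro n
      have := hcoeff n
      rw [hG0, Polynomial.coeff_zero] at this
      exact sub_eq_zero.1 this.symm
    have hcross : ∀ k, P * (toPoly v Q).coeff k = Q * (toPoly v P).coeff k := by
      intro k
      apply hinj
      rw [map_mul, map_mul, h0 k, hz]
      field_simp
    obtain ⟨hvP, hvQ⟩ := notMem_vars_of_mul_coeff_eq hQ hPQ hcross
    rcases max_choice (ord () P) (ord () Q) with h' | h'
    · exact hvP (mem_vars_of_ord_eq (h'.symm.trans h))
    · exact hvQ (mem_vars_of_ord_eq (h'.symm.trans h))
  · refine mem_algCl_of_root hG0 (fun n => ?_) hroot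
    rw [hcoeff]
    exact sub_mem (evalAt_mem hlow (coeff_toPoly_mem_supported v hPs n))
      (mul_mem (subset_algCl _ (Or.inl rfl))
        (evalAt_mem hlow (coeff_toPoly_mem_supported v hQs n)))

variable [CharZero F] [Differential F] [DifferentialAlgebra F E]

theorem HasOrder.deriv (h : HasOrder F u z a) : HasOrder F u (Differential.deriv z) (a + 1) := by
  have h1 : z ∈ algCl F (derivsLT u (a + 1)) := h.mem_algCl
  constructor
  · exact deriv_mem_algCl ((derivsLT_mono u (Nat.le_succ _)).trans (subset_algCl _))
      ((derivSet_derivsLT_subset u _).trans (subset_algCl _)) h1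
  · rw [iterDeriv_succ]
    have hle : derivsLT u (a + 1) ⊆
        algCl F (insert (Differential.deriv z) (derivsLT u (a + 1))) :=
      (Set.subset_insert _ _).trans (subset_algCl _)
    refine deriv_mem_algCl (S := insert z (derivsLT u a)) ?_ ?_ h.iterDeriv_mem_algCl
    · exact Set.insert_subset (algCl_le hle h1) ((derivsLT_mono u (Nat.le_succ a)).trans hle)
    · rintro _ ⟨x, rfl | hx, rfl⟩
      · exact subset_algCl _ (Or.inl rfl)
      · exact hle (derivSet_derivsLT_subset u a ⟨x, hx, rfl⟩)

theorem HasOrder.iterate (h : HasOrder F u z a) (k : ℕ) :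
    HasOrder F u (iterDeriv k z) (a + k) := by
  induction k with
  | zero => exact h
  | succ k ih =>
    rw [iterDeriv_succ]
    exact ih.deriv

/-- The derivatives of `u` of order less than `a`, followed by the derivatives of `z`. -/
def mixedSeq (u z : E) (a n : ℕ) : E := if n < a then iterDeriv n u else iterDeriv (n - a) z

theorem mixedSeq_add (u z : E) (a n : ℕ) : mixedSeq u z a (a + n) = iterDeriv n z := by
  simp [mixedSeq]

theorem mixedSeq_of_lt (u z : E) {a n : ℕ} (h : n < a) :
    mixedSeq u z a n = iterDeriv n u := if_pos h

theorem HasOrder.of_mixedSeq (h : HasOrder F u z a) (n : ℕ) : HasOrder F u (mixedSeq u z a n) n := by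
  rcases lt_or_ge n a with hn | hn
  · rw [mixedSeq_of_lt u z hn]
    exact ⟨subset_algCl _ ⟨n, n.lt_succ_self, rfl⟩, subset_algCl _ (Or.inl rfl)⟩
  · obtain ⟨k, rfl⟩ := Nat.exists_eq_add_of_le hn
    rw [mixedSeq_add]
    exact h.iterate k

/-- If `z` has order `a`, then the derivatives of `u` of order less than `a` and all derivatives
of `z` are algebraically independent. -/
theorem HasOrder.indep_mixedSeq (hu : DiffTranscendental F u) (h : HasOrder F u z a) :
    Function.Injective (mixedSeq u z a) ∧
      (AlgebraicIndependent.matroid F E).Indep (Set.range (mixedSeq u z a)) := by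
  have hle : ∀ n, algCl F (mixedSeq u z a '' Set.Iio n) ≤ algCl F (derivsLT u n) := by
    intro n
    refine algCl_le ?_
    rintro _ ⟨k, hk, rfl⟩
    exact algCl_mono (derivsLT_mono u (Nat.succ_le_of_lt hk)) (h.of_mixedSeq k).mem_algCl
  refine indep_range_of_notMem_closure (fun _ => Set.mem_univ _) fun n hn => ?_
  rw [← coe_algCl] at hn
  refine hu.iterDeriv_notMem n (algCl_le ?_ (h.of_mixedSeq n).iterDeriv_mem_algCl)
  exact Set.insert_subset (hle n hn) (subset_algCl _)

end Order

theorem self_mem_sat {σ F : Type*} [Field F] [Differential F] {r : Ranking σ} {A : DiffPoly σ F}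
    (h : (sat r A).Nonempty) : A ∈ sat r A := by
  obtain ⟨f, v, hv, -⟩ := h
  refine ⟨v, hv, 0, ?_⟩
  rw [pow_zero, one_mul]
  exact Ideal.subset_span ⟨A, rfl, 0, rfl⟩

/-! ### Orders of the coordinates of a generic point -/

section GenericPoint

variable {F E : Type*} [Field F] [CharZero F] [Differential F] [Field E] [Differential E]
  [Algebra F E] {r : Ranking (Fin 2)} {A : DiffPoly (Fin 2) F} {η : Fin 2 → E}

/-- A polynomial that vanishes at a generic point of `sat(A)` and whose order in the leading
variable is at most that of `A` is divisible by `A`. -/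
theorem dvd_of_evalAt_eq_zero (hirr : Irreducible A)
    (hgen : ∀ f : DiffPoly (Fin 2) F, evalAt η f = 0 → f ∈ sat r A) {f : DiffPoly (Fin 2) F}
    (hf : evalAt η f = 0) : ∃ v ∈ A.vars, A ∈ supported F (ordLE v.1 v.2) ∧
      (f ∈ supported F (ordLE v.1 v.2) → A ∣ f) :=
  dvd_of_mem_sat hirr (hgen f hf)

/-- At a generic point, the value of each derivative in `A` is algebraic over the values of the
others. -/
theorem iterDeriv_mem_algCl_of_mem_vars (hirr : Irreducible A)
    (hgen : ∀ f : DiffPoly (Fin 2) F, evalAt η f = 0 ↔ f ∈ sat r A) {v : Fin 2 × ℕ}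
    (hv : v ∈ A.vars) {S : Set E} (hS : ∀ w ∈ A.vars, w ≠ v → iterDeriv w.2 (η w.1) ∈ algCl F S) :
    iterDeriv v.2 (η v.1) ∈ algCl F S := by
  set φ := evalAt (F := F) η with hφ
  have hA : φ A = 0 := (hgen A).2 (self_mem_sat ⟨0, (hgen 0).1 (map_zero _)⟩)
  set c := (toPoly v A).leadingCoeff with hc
  have hc0 : c ≠ 0 := Polynomial.leadingCoeff_ne_zero.2 (toPoly_ne_zero v hirr.ne_zero)
  have hcoeff : ∀ n, (toPoly v A).coeff n ∈ supported F ((A.vars : Set (Fin 2 × ℕ)) \ {v}) :=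
    coeff_toPoly_mem_supported v (mem_supported_vars A)
  have hφc : φ c ≠ 0 := by
    intro h
    obtain ⟨w, -, hw, hdvd⟩ := dvd_of_evalAt_eq_zero hirr (fun f => (hgen f).1) h
    refine not_dvd_of_mem_supported hc0 hv (hcoeff _) (fun h => h.2 rfl) (hdvd ?_)
    exact supported_mono (Set.sdiff_subset.trans (mem_supported.1 hw)) (hcoeff _)
  have hp : (toPoly v A).map (φ : DiffPoly (Fin 2) F →+* E) ≠ 0 := by
    intro h
    have := congrArg (fun p => p.coeff (toPoly v A).natDegree) h
    simp only [Polynomial.coeff_map, Polynomial.coeff_zero] at this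
    exact hφc this
  refine mem_algCl_of_root hp (fun n => ?_) (z := iterDeriv v.2 (η v.1)) ?_
  · rw [Polynomial.coeff_map]
    exact evalAt_mem (fun w hw => hS w hw.1 hw.2) (hcoeff n)
  · rw [← evalAt_X (F := F), eval_map_toPoly, hA]

/-- If one coordinate of a generic point is constant, then `A` is linear of order `0` in that
coordinate, and does not involve the other one. -/
theorem vars_eq_singleton_of_eq_algebraMap (hirr : Irreducible A)
    (hgen : ∀ f : DiffPoly (Fin 2) F, evalAt η f = 0 ↔ f ∈ sat r A) {i : Fin 2} {c : F}
    (hc : η i = algebraMap F E c) : A.vars = {(i, 0)} := by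
  have h0 : evalAt η (X (i, 0) - C c : DiffPoly (Fin 2) F) = 0 := by
    rw [map_sub, evalAt_X, ← algebraMap_eq, AlgHom.commutes, ← hc]
    exact sub_self _
  have hne : (X (i, 0) - C c : DiffPoly (Fin 2) F) ≠ 0 := by
    intro h
    have h1 := congrArg (pderiv (i, 0)) h
    rw [map_sub, pderiv_X_self, pderiv_C, sub_zero, map_zero] at h1
    exact one_ne_zero h1
  have hs : (X (i, 0) - C c : DiffPoly (Fin 2) F) ∈ supported F {(i, 0)} :=
    sub_mem (X_mem_supported.2 rfl) (Subalgebra.algebraMap_mem _ c)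
  obtain ⟨v, hv, -, hdvd⟩ := dvd_of_evalAt_eq_zero hirr (fun f => (hgen f).1) h0
  have hd := hdvd (supported_mono (by rintro _ rfl _; exact Nat.zero_le _) hs)
  have hsub := (Finset.coe_subset.2 (vars_subset_of_dvd hd hne)).trans (mem_supported.1 hs)
  rw [← Finset.coe_singleton, Finset.coe_subset] at hsub
  exact (Finset.subset_singleton_iff.1 hsub).resolve_left (Finset.ne_empty_of_mem hv)

variable [DifferentialAlgebra F E] {u : E}

/-- The order of the coordinate `η_i` is at most the order of `A` in the other variable. -/
theorem HasOrder.le_ord (hirr : Irreducible A)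
    (hgen : ∀ f : DiffPoly (Fin 2) F, evalAt η f = 0 ↔ f ∈ sat r A)
    (hu : DiffTranscendental F u) (hproper : u ∈ diffAdjoin F (Set.range η)) {i j : Fin 2}
    (hij : i ≠ j) {a q : ℕ} (h : HasOrder F u (η i) a) (hq : ord j A = q) : a ≤ q := by
  set Z := Set.range fun k => iterDeriv k (η i) with hZ
  set J := derivsLT (η j) q with hJ
  have hZS : Z ⊆ algCl F (J ∪ Z) := Set.subset_union_right.trans (subset_algCl _)
  have hJS : J ⊆ algCl F (J ∪ Z) := Set.subset_union_left.trans (subset_algCl _)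
  have hcases : ∀ k : Fin 2, k = i ∨ k = j := by
    intro k
    omega
  have htop : iterDeriv q (η j) ∈ algCl F (J ∪ Z) := by
    refine iterDeriv_mem_algCl_of_mem_vars hirr hgen (mem_vars_of_ord_eq hq) ?_
    rintro ⟨k, n⟩ hw hne
    rcases hcases k with rfl | rfl
    · exact hZS ⟨n, rfl⟩
    · have hn : n ≤ q := mem_supported.1 (ord_le_coe_iff.1 hq.le) hw rfl
      exact hJS ⟨n, lt_of_le_of_ne hn fun h => hne (by rw [h]), rfl⟩
  have hderiv : ∀ z ∈ algCl F (J ∪ Z), Differential.deriv z ∈ algCl F (J ∪ Z) := by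
    intro z hz
    refine deriv_mem_algCl (subset_algCl _) ?_ hz
    rintro _ ⟨x, hx | ⟨k, rfl⟩, rfl⟩
    · obtain ⟨k, hk, hkx⟩ := derivSet_derivsLT_subset (η j) q ⟨x, hx, rfl⟩
      rcases Nat.lt_succ_iff_lt_or_eq.1 hk with hk | rfl
      · exact hkx ▸ hJS ⟨k, hk, rfl⟩
      · exact hkx ▸ htop
    · exact hZS ⟨k + 1, iterDeriv_succ k _⟩
  have hiter : ∀ z ∈ algCl F (J ∪ Z), ∀ k, iterDeriv k z ∈ algCl F (J ∪ Z) := by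
    intro z hz k
    induction k with
    | zero => exact hz
    | succ k ih =>
      rw [iterDeriv_succ]
      exact hderiv _ ih
  have hj : η j ∈ algCl F (J ∪ Z) := by
    rcases Nat.eq_zero_or_pos q with rfl | hq0
    · exact htop
    · exact hJS ⟨0, hq0, rfl⟩
  have hη : ∀ k, η k ∈ algCl F (J ∪ Z) := by
    intro k
    rcases hcases k with rfl | rfl
    exacts [hZS ⟨0, rfl⟩, hj]
  have huS : u ∈ algCl F (J ∪ Z) := by
    refine IntermediateField.adjoin_le_iff.2 ?_ hproper
    rintro _ ⟨_, ⟨k, rfl⟩, n, rfl⟩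
    exact hiter _ (hη k) n
  obtain ⟨hinj, hind⟩ := h.indep_mixedSeq hu
  have hI : derivsLT u a = mixedSeq u (η i) a '' Set.Iio a :=
    Set.image_congr fun k hk => (mixedSeq_of_lt u (η i) hk).symm
  have hZ' : Z ⊆ mixedSeq u (η i) a '' Set.Ici a := by
    rintro _ ⟨k, rfl⟩
    exact ⟨a + k, Nat.le_add_right a k, mixedSeq_add u (η i) a k⟩
  have hdisj : Disjoint (derivsLT u a) Z := by
    rw [hI]
    refine Disjoint.mono_right hZ' ((Set.disjoint_image_iff hinj).2 ?_)
    exact Set.disjoint_left.2 fun k hk hk' => not_lt.2 (Set.mem_Ici.1 hk') hk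
  have hsub : derivsLT u a ∪ Z ⊆ Set.range (mixedSeq u (η i) a) :=
    Set.union_subset (hI ▸ Set.image_subset_range _ _) (hZ'.trans (Set.image_subset_range _ _))
  have hle := encard_le_of_subset_closure_union hdisj (hind.subset hsub) (J := J) (by
    rw [← coe_algCl]
    rintro _ ⟨k, -, rfl⟩
    exact hiter u huS k)
  have hcard : (derivsLT u a).encard = a := by
    rw [hI, hinj.encard_image, ← Finset.coe_range, Set.encard_coe_eq_coe_finsetCard,
      Finset.card_range]
  rw [hcard] at hle
  exact_mod_cast hle.trans (encard_derivsLT_le (η j) q)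

/-- If the coordinate `η_i` is not constant, then `A` involves the other variable. -/
theorem HasOrder.ord_ne_bot (hirr : Irreducible A)
    (hgen : ∀ f : DiffPoly (Fin 2) F, evalAt η f = 0 ↔ f ∈ sat r A)
    (hu : DiffTranscendental F u) {i j : Fin 2} (hij : i ≠ j) {a : ℕ}
    (h : HasOrder F u (η i) a) : ord j A ≠ ⊥ := by
  intro hbot
  obtain ⟨⟨k, n⟩, hv, -⟩ := dvd_of_evalAt_eq_zero hirr (fun f => (hgen f).1) (map_zero (evalAt η))
  have hvars : ∀ w ∈ A.vars, w.1 = i := by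
    intro w hw
    have := ord_eq_bot_iff.1 hbot w hw
    omega
  obtain rfl : k = i := hvars _ hv
  obtain ⟨hinj, hind⟩ := h.indep_mixedSeq hu
  have hmem := iterDeriv_mem_algCl_of_mem_vars hirr hgen hv
    (S := Set.range (mixedSeq u (η k) a) \ {iterDeriv n (η k)}) (by
      rintro ⟨l, m⟩ hw hne
      obtain rfl : l = k := hvars _ hw
      refine subset_algCl _ ⟨⟨a + m, mixedSeq_add u (η l) a m⟩, fun he => hne ?_⟩
      rw [Set.mem_singleton_iff, ← mixedSeq_add u (η l) a, ← mixedSeq_add u (η l) a] at he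
      exact congrArg _ (Nat.add_left_cancel (hinj he)))
  rw [← SetLike.mem_coe, coe_algCl] at hmem
  exact hind.notMem_closure_sdiff_of_mem ⟨a + n, mixedSeq_add u (η k) a n⟩ hmem

/-- There is a nonzero relation between the coordinates whose order in each coordinate is at most
the order of the other coordinate with respect to `u`. -/
theorem exists_relation {a : Fin 2 → ℕ}
    (h : ∀ i, HasOrder F u (η i) (a i)) :
    ∃ f : DiffPoly (Fin 2) F, f ≠ 0 ∧ evalAt η f = 0 ∧ ∀ i, f ∈ supported F (ordLE i (a i.rev)) := by
  let W : Finset (Fin 2 × ℕ) := {0} ×ˢ Finset.range (a 1 + 1) ∪ {1} ×ˢ Finset.range (a 0 + 1)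
  have hW : ∀ w ∈ W, w.2 ≤ a w.1.rev := by
    rintro ⟨k, n⟩ hw
    simp only [W, Finset.mem_union, Finset.mem_product, Finset.mem_singleton, Finset.mem_range] at hw
    rcases hw with ⟨rfl, hn⟩ | ⟨rfl, hn⟩
    · exact Nat.le_of_lt_succ hn
    · exact Nat.le_of_lt_succ hn
  have hcardW : W.card = a 0 + a 1 + 2 := by
    rw [Finset.card_union_of_disjoint]
    · simp
      omega
    · rw [Finset.disjoint_left]
      rintro ⟨k, n⟩ h1 h2
      simp only [Finset.mem_product, Finset.mem_singleton] at h1 h2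
      omega
  by_contra! hcon
  set x : Fin 2 × ℕ → E := fun w => iterDeriv w.2 (η w.1) with hx
  have hind : AlgebraicIndependent F (x ∘ (Subtype.val : ↥(W : Set (Fin 2 × ℕ)) → Fin 2 × ℕ)) := by
    rw [algebraicIndependent_comp_subtype]
    intro f hf hf0
    by_contra hne
    obtain ⟨i, hi⟩ := hcon f hne hf0
    refine hi (supported_mono ?_ hf)
    rintro w hw rfl
    exact hW w hw
  set s := Set.range (x ∘ (Subtype.val : ↥(W : Set (Fin 2 × ℕ)) → Fin 2 × ℕ)) with hs
  have hmat : (AlgebraicIndependent.matroid F E).Indep s :=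
    AlgebraicIndependent.matroid_indep_iff.2 hind.coe_range
  have hcard : s.encard = (a 0 + a 1 + 2 : ℕ) := by
    rw [hs, ← Set.image_univ, hind.injective.encard_image, Set.encard_univ, ← hcardW]
    simp
  have hsub : s ⊆ algCl F (derivsLT u (a 0 + a 1 + 1)) := by
    rintro _ ⟨⟨w, hw⟩, rfl⟩
    refine algCl_mono (derivsLT_mono u ?_) ((h w.1).iterate w.2).mem_algCl
    have := hW w hw
    rcases w with ⟨k, n⟩
    fin_cases k
    · change n ≤ a 1 at this
      change a 0 + n + 1 ≤ _
      omega
    · change n ≤ a 0 at this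
      change a 1 + n + 1 ≤ _
      omega
  rw [coe_algCl] at hsub
  have hle : s.encard ≤ (a 0 + a 1 + 1 : ℕ) := by
    refine (hmat.encard_le_eRk_of_subset hsub).trans ?_
    rw [Matroid.eRk_closure_eq]
    exact (Matroid.eRk_le_encard _ _).trans (encard_derivsLT_le _ _)
  rw [hcard, Nat.cast_le] at hle
  omega

/-- If no coordinate is constant, then the order of each coordinate of a generic point that
generates `F⟨u⟩` is the order of `A` in the other variable. -/
theorem ord_eq_of_hasOrder (hirr : Irreducible A)
    (hgen : ∀ f : DiffPoly (Fin 2) F, evalAt η f = 0 ↔ f ∈ sat r A)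
    (hu : DiffTranscendental F u) (hproper : u ∈ diffAdjoin F (Set.range η)) {a : Fin 2 → ℕ}
    (h : ∀ i, HasOrder F u (η i) (a i)) (i : Fin 2) : ord i A = a i.rev := by
  have hne : ∀ i : Fin 2, i.rev ≠ i := by decide
  obtain ⟨f, hf0, hf, hfs⟩ := exists_relation h
  obtain ⟨v, hv, hAv, hdvd⟩ := dvd_of_evalAt_eq_zero hirr (fun f => (hgen f).1) hf
  have hle : a v.1.rev ≤ v.2 :=
    (h _).le_ord hirr hgen hu hproper (hne v.1) (ord_eq_of_mem_vars hv hAv)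
  have hd : A ∣ f := hdvd (supported_mono (ordLE_mono _ hle) (hfs v.1))
  have hAi : A ∈ supported F (ordLE i (a i.rev)) :=
    mem_supported.2 ((Finset.coe_subset.2 (vars_subset_of_dvd hd hf0)).trans
      (mem_supported.1 (hfs i)))
  obtain ⟨q, hq⟩ := WithBot.ne_bot_iff_exists.1 ((h i.rev).ord_ne_bot hirr hgen hu (hne i))
  refine le_antisymm (ord_le_coe_iff.2 hAi) ?_
  rw [← hq]
  exact WithBot.coe_le_coe.2 ((h _).le_ord hirr hgen hu hproper (hne i) hq.symm)

end GenericPoint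

/-- The order of each coordinate of a proper parametrization is the order of the curve in the other
variable. -/
theorem IsRationalParametrization.ordFrac_eq {F E : Type*} [Field F] [CharZero F] [Differential F]
    [Field E] [Differential E] [Algebra F E] [DifferentialAlgebra F E] {r : Ranking (Fin 2)}
    {C : Set (Fin 2 → E)} {A : DiffPoly (Fin 2) F} {u : E} {P Q : Fin 2 → DiffPoly Unit F}
    (h : IsRationalParametrization r C A u P Q) (hproper : IsProper u P Q) {i j : Fin 2}
    (hij : i ≠ j) : ordFrac (P i) (Q i) = ord j A := by
  have hirr := h.isCurve.irreducible
  have hu := h.diffTranscendental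
  have hgen : ∀ f : DiffPoly (Fin 2) F, evalAt (paramPoint u P Q) f = 0 ↔ f ∈ sat r A := by
    intro f
    rw [← h.generic]
    rfl
  have hmem : u ∈ diffAdjoin F (Set.range (paramPoint u P Q)) := by
    rw [hproper]
    exact IntermediateField.subset_adjoin F _ ⟨u, rfl, 0, rfl⟩
  have hconst : ∀ k, ordFrac (P k) (Q k) = ⊥ → A.vars = {(k, 0)} := fun k hk => by
    obtain ⟨c, hc⟩ := exists_eq_algebraMap_of_ordFrac_eq_bot (u := u) hk
    exact vars_eq_singleton_of_eq_algebraMap hirr hgen hc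
  have hord : ∀ {k : Fin 2} {a : ℕ}, ordFrac (P k) (Q k) = a →
      HasOrder F u (paramPoint u P Q k) a := fun {k a} hk =>
    hasOrder_of_ordFrac_eq hu (h.den_ne_zero k) (h.reduced k) hk
  rcases hi : ordFrac (P i) (Q i) with _ | a
  · refine (ord_eq_bot_iff.2 fun w hw => ?_).symm
    rw [hconst i hi, Finset.mem_singleton] at hw
    rwa [hw]
  rcases hj : ordFrac (P j) (Q j) with _ | b
  · have hA := hconst j hj
    have hv : (j, 0) ∈ A.vars := hA ▸ Finset.mem_singleton_self _
    have h0 : ord j A = (0 : ℕ) := ord_eq_of_mem_vars hv <| mem_supported.2 <| by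
      rw [hA, Finset.coe_singleton]
      rintro _ rfl _
      exact le_rfl
    have := (hord hi).le_ord hirr hgen hu hmem hij h0
    rw [h0, Nat.le_zero.1 this]
    rfl
  · have hall : ∀ k, ∃ n : ℕ, ordFrac (P k) (Q k) = n := by
      intro k
      have : k = i ∨ k = j := by omega
      rcases this with rfl | rfl
      exacts [⟨a, hi⟩, ⟨b, hj⟩]
    choose n hn using hall
    have := ord_eq_of_hasOrder hirr hgen hu hmem (fun k => hord (hn k)) j
    have hrev : ∀ i j : Fin 2, i ≠ j → j.rev = i := by decide
    obtain rfl := hrev i j hij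
    rw [this, ← hn]
    exact hi.symm

end DiffCurve

end

theorem theorem3p1 {F E : Type*} [Field F] [CharZero F] [Differential F]
    [Field E] [Differential E] [Algebra F E] [DifferentialAlgebra F E]
    (r : DiffCurve.Ranking (Fin 2))
    (C : Set (Fin 2 → E)) (A : DiffCurve.DiffPoly (Fin 2) F)
    (u : E) (P Q : Fin 2 → DiffCurve.DiffPoly Unit F)
    (hparam : DiffCurve.IsRationalParametrization r C A u P Q)
    (hproper : DiffCurve.IsProper u P Q) :
    DiffCurve.ordFrac (P 0) (Q 0) = DiffCurve.ord 1 A ∧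
      DiffCurve.ordFrac (P 1) (Q 1) = DiffCurve.ord 0 A :=
  ⟨hparam.ordFrac_eq hproper (by decide), hparam.ordFrac_eq hproper (by decide)⟩
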